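/- Let $(M,d,\mathbf m)$ be a complete metric space with a Radon measure $\mathbf m$ that is finite on bounded sets, and let $N\in\mathbb N$. For $f:M\to\mathbb R$ put $\operatorname{lip}f(x)=\limsup_{y\to x,\,y\ne x}\frac{|f(y)-f(x)|}{d(x,y)}$ (equal to $0$ at isolated points). Lipschitz functions $f_1,\dots,f_n$ are *independent* on $A\subset M$ if for $\mathbf m$-a.e. $x\in A$ the map $c\mapsto\operatorname{lip}\big(\sum_i c_if_i\big)(x)$ is a norm on $\mathbb R^n$. The space $(M,d,\mathbf m)$ is a *Lipschitz differentiability space with constant $N$* if at most $N$ Lipschitz functions can be independent on a Borel set of positive measure. For $p\in(1,\infty)$ let $\mathsf{Pfm}_p$ be the set of families $(f_i,A_i)_{i\in\mathbb N}$ where $(A_i)$ is a Borel partition of $M$, each $f_i$ is Lipschitz with $\operatorname{lip}f_i\in L^p(\mathbf m)$, and $\sum_i\int_{A_i}(\operatorname{lip}f_i)^p\,d\mathbf m<\infty$. It carries the pointwise norm $|(f_i,A_i)_i|=\operatorname{lip}f_i$ on $A_i$, the seminorm $\|v\|=\||v|\|_{L^p(\mathbf m)}$, and the piecewise linear operations,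 with $(f_i,A_i)_i+(h_j,B_j)_j=(f_i+h_j,A_i\cap B_j)_{i,j}$; two families are identified when their difference has pointwise norm $0$ a.e. The *$L^p$-Lipschitz module* $L^p_{\operatorname{lip}}(T^*M)$ is the completion of $\mathsf{Pfm}_p$, with $|\cdot|:L^p_{\operatorname{lip}}(T^*M)\to L^p(\mathbf m)$ extended by continuity. A set $S\subset L^p_{\operatorname{lip}}(T^*M)$ is *independent on $A$* if for any distinct $v_1,\dots,v_n\in S$ the map $c\mapsto|\sum_ic_iv_i|_x$ is a norm on $\mathbb R^n$ for $\mathbf m$-a.e. $x\in A$. The module is *locally finite dimensional with bound $N$* if there is a Borel partition $\{E_n\}_{n=0}^\infty\cup\{E_\infty\}$ of $M$ with $\mathbf m(E_\infty)=0$ and $\mathbf m(E_n)=0$ for all finite $n>N$, such that for every $n\in\mathbb N$ and every Borel $A\subset E_n$ with $\mathbf m(A)>0$, each set $S$ that is maximal among the sets that are independent on $A$ and whose elements vanish a.e. outside $A$ has exactly $n$ elements. Then the following are equivalent: 1. $(M,d,\mathbf m)$ is a Lipschitz differentiability space with constant $N$; 2. $L^p_{\operatorname{lip}}(T^*M)$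 is locally finite dimensional with bound $N$ for some $p\in(1,\infty)$; 3. $L^p_{\operatorname{lip}}(T^*M)$ is locally finite dimensional with bound $N$ for all $p\in(1,\infty)$. -/

import Mathlib

open MeasureTheory Filter Topology
open scoped ENNReal NNReal

noncomputable section

namespace LipMod

variable {M : Type*} [MetricSpace M]

/-- The local Lipschitz constant `lip f (x) = limsup_{y → x, y ≠ x} |f y - f x| / d(y, x)`,
with values in `[0, ∞]`; it is `0` at isolated points. -/
def locLip (f : M → ℝ) (x : M) : ℝ≥0∞ :=
  limsup (fun y => edist (f y) (f x) / edist y x) (𝓝[≠] x)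

theorem locLip_add_le (f g : M → ℝ) (x : M) :
    locLip (f + g) x ≤ locLip f x + locLip g x := by
  refine ENNReal.le_of_forall_pos_le_add fun ε hε htop => ?_
  have hf : locLip f x ≠ ∞ := fun h => by simp [h] at htop
  have hg : locLip g x ≠ ∞ := fun h => by simp [h] at htop
  have hε2 : (ε / 2 : ℝ≥0∞) ≠ 0 := by simp [hε.ne']
  have e1 := eventually_lt_of_limsup_lt (ENNReal.lt_add_right hf hε2)
  have e2 := eventually_lt_of_limsup_lt (ENNReal.lt_add_right hg hε2)
  have h : locLip (f + g) x ≤ (locLip f x + ε / 2) + (locLip g x + ε / 2) := by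
    refine limsup_le_of_le (by isBoundedDefault) ?_
    filter_upwards [e1, e2] with y h1 h2
    refine le_trans ?_ (add_le_add h1.le h2.le)
    simp only [Pi.add_apply]
    rw [← ENNReal.add_div]
    exact ENNReal.div_le_div_right (edist_add_add_le _ _ _ _) _
  refine h.trans (le_of_eq ?_)
  rw [add_add_add_comm, ENNReal.add_halves]

theorem locLip_smul (c : ℝ) (f : M → ℝ) (x : M) :
    locLip (c • f) x = ‖c‖ₑ * locLip f x := by
  unfold locLip
  rw [← ENNReal.limsup_const_mul_of_ne_top enorm_ne_top]
  congr 1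
  funext y
  simp only [Pi.smul_apply, edist_smul₀]
  rw [ENNReal.smul_def, smul_eq_mul, mul_div_assoc]
  rfl

theorem locLip_zero (x : M) : locLip (0 : M → ℝ) x = 0 := by
  have h := locLip_smul 0 (0 : M → ℝ) x
  simpa using h

theorem locLip_le {K : ℝ≥0} {f : M → ℝ} (hf : LipschitzWith K f) (x : M) :
    locLip f x ≤ K := by
  unfold locLip
  refine limsup_le_of_le (by isBoundedDefault) (Eventually.of_forall fun y => ?_)
  exact ENNReal.div_le_of_le_mul (hf y x)

theorem measurable_locLip [MeasurableSpace M] [BorelSpace M] {f : M → ℝ} (hf : Continuous f) :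
    Measurable (locLip f) := by
  have key : locLip f = fun x => ⨅ n : ℕ, ⨆ y ∈ {y : M | dist y x < 1 / ((n : ℝ) + 1) ∧ y ≠ x},
      edist (f y) (f x) / edist y x := by
    funext x
    have hb := nhdsWithin_hasBasis (Metric.nhds_basis_ball_inv_nat_succ (x := x)) {x}ᶜ
    unfold locLip
    rw [hb.limsup_eq_iInf_iSup]
    simp only [iInf_true]
    rfl
  rw [key]
  refine Measurable.iInf fun n => LowerSemicontinuous.measurable ?_
  rw [lowerSemicontinuous_iff_isOpen_preimage]
  intro c
  rw [isOpen_iff_mem_nhds]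
  intro x hx
  simp only [Set.mem_preimage, Set.mem_Ioi, lt_iSup_iff] at hx
  obtain ⟨y, ⟨hy1, hy2⟩, hy3⟩ := hx
  have e1 : ∀ᶠ z in 𝓝 x, dist y z < 1 / ((n : ℝ) + 1) :=
    (continuous_const.dist continuous_id).continuousAt.eventually_lt_const hy1
  have e2 : ∀ᶠ z in 𝓝 x, y ≠ z := by
    filter_upwards [isOpen_ne.mem_nhds hy2.symm] with z hz using hz.symm
  have e3 : ∀ᶠ z in 𝓝 x, c < edist (f y) (f z) / edist y z := by
    have hc : ContinuousAt (fun z => edist (f y) (f z) / edist y z) x := by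
      refine ENNReal.Tendsto.div
        (continuous_const.edist hf).continuousAt (Or.inr ?_)
        (continuous_const.edist continuous_id).continuousAt (Or.inr (edist_ne_top _ _))
      simpa using hy2
    exact hc.eventually_const_lt hy3
  filter_upwards [e1, e2, e3] with z h1 h2 h3
  simp only [Set.mem_preimage, Set.mem_Ioi, lt_iSup_iff]
  exact ⟨y, ⟨h1, h2⟩, h3⟩

/-- The pointwise norm `x ↦ lip (F x) (x)` of `F : M → (M → ℝ)`; if `F = f i` on `A i`
this is `lip (f i)` on `A i`. -/
def preNorm (F : M → M → ℝ) (x : M) : ℝ := (locLip (F x) x).toReal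

theorem preNorm_nonneg (F : M → M → ℝ) (x : M) : 0 ≤ preNorm F x := ENNReal.toReal_nonneg

theorem preNorm_smul (c : ℝ) (F : M → M → ℝ) (x : M) :
    preNorm (c • F) x = |c| * preNorm F x := by
  simp [preNorm, locLip_smul, ENNReal.toReal_mul]

variable [MeasurableSpace M]

/-- The domain of `f ↦ lip f`: Lipschitz functions with `lip f ∈ L^p(m)`. -/
def lipDomain (p : ℝ≥0∞) (m : Measure M) : Set (M → ℝ) :=
  {f | (∃ K : ℝ≥0, LipschitzWith K f) ∧ MemLp (fun x => (locLip f x).toReal) p m}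

/-- A family `(f i, A i)`, with `(A i)` a Borel partition and each `f i` in the domain of
`f ↦ lip f`, is encoded as the map `F` on `M` with `F x = f i` for `x ∈ A i`. -/
def IsPiecewise (p : ℝ≥0∞) (m : Measure M) (F : M → M → ℝ) : Prop :=
  ∃ (A : ℕ → Set M) (f : ℕ → M → ℝ), (∀ i, MeasurableSet (A i)) ∧
    Pairwise (fun i j => Disjoint (A i) (A j)) ∧ (⋃ i, A i) = Set.univ ∧
    (∀ i, f i ∈ lipDomain p m) ∧ ∀ i, ∀ x ∈ A i, F x = f i

theorem IsPiecewise.ne_top {p : ℝ≥0∞} {m : Measure M} {F : M → M → ℝ} (hF : IsPiecewise p m F)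
    (x : M) : locLip (F x) x ≠ ∞ := by
  obtain ⟨A, f, -, -, hU, hf, hFf⟩ := hF
  obtain ⟨i, hi⟩ := Set.mem_iUnion.1 (hU.symm ▸ Set.mem_univ x : x ∈ ⋃ i, A i)
  obtain ⟨K, hK⟩ := (hf i).1
  rw [hFf i x hi]
  exact ne_top_of_le_ne_top ENNReal.coe_ne_top (locLip_le hK x)

theorem preNorm_add_le {p : ℝ≥0∞} {m : Measure M} {F G : M → M → ℝ} (hF : IsPiecewise p m F)
    (hG : IsPiecewise p m G) (x : M) : preNorm (F + G) x ≤ preNorm F x + preNorm G x := by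
  unfold preNorm
  rw [← ENNReal.toReal_add (hF.ne_top x) (hG.ne_top x)]
  exact ENNReal.toReal_mono (ENNReal.add_ne_top.2 ⟨hF.ne_top x, hG.ne_top x⟩)
    (locLip_add_le _ _ _)

theorem lipDomain_smul {p : ℝ≥0∞} {m : Measure M} (c : ℝ) {f : M → ℝ} (hf : f ∈ lipDomain p m) :
    c • f ∈ lipDomain p m := by
  obtain ⟨⟨K, hK⟩, hf2⟩ := hf
  refine ⟨⟨‖c‖₊ * K, (lipschitzWith_smul c).comp hK⟩, ?_⟩
  have : (fun x => (locLip (c • f) x).toReal) = fun x => |c| * (locLip f x).toReal := by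
    funext x
    simp [locLip_smul, ENNReal.toReal_mul]
  rw [this]
  exact hf2.const_mul _

theorem IsPiecewise.zero {p : ℝ≥0∞} {m : Measure M} : IsPiecewise p m (0 : M → M → ℝ) := by
  refine ⟨fun k => if k = 0 then Set.univ else ∅, fun _ => 0, ?_, ?_, ?_, ?_, ?_⟩
  · intro i
    dsimp only
    split_ifs <;> simp
  · intro i j hij
    dsimp only
    split_ifs <;> simp_all
  · exact Set.eq_univ_of_forall fun x => Set.mem_iUnion.2 ⟨0, by simp⟩
  · exact fun i => ⟨⟨0, LipschitzWith.const 0⟩, by simp [locLip_zero]⟩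
  · intro i x _
    rfl

theorem IsPiecewise.smul {p : ℝ≥0∞} {m : Measure M} (c : ℝ) {F : M → M → ℝ}
    (hF : IsPiecewise p m F) : IsPiecewise p m (c • F) := by
  obtain ⟨A, f, hA, hAd, hAU, hf, hFf⟩ := hF
  refine ⟨A, fun k => c • f k, hA, hAd, hAU, fun k => lipDomain_smul c (hf k), ?_⟩
  intro k x hx
  simp only [Pi.smul_apply]
  rw [hFf k x hx]

variable [BorelSpace M]

theorem IsPiecewise.measurable_preNorm {p : ℝ≥0∞} {m : Measure M} {F : M → M → ℝ}
    (hF : IsPiecewise p m F) : Measurable (preNorm F) := by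
  obtain ⟨A, f, hA, -, hU, hf, hFf⟩ := hF
  intro s hs
  have : preNorm F ⁻¹' s = ⋃ i, A i ∩ (fun x => (locLip (f i) x).toReal) ⁻¹' s := by
    ext x
    obtain ⟨i, hi⟩ := Set.mem_iUnion.1 (hU.symm ▸ Set.mem_univ x : x ∈ ⋃ i, A i)
    simp only [Set.mem_preimage, Set.mem_iUnion, Set.mem_inter_iff, preNorm]
    constructor
    · intro h
      exact ⟨i, hi, by rwa [← hFf i x hi]⟩
    · rintro ⟨j, hj, h⟩
      rwa [hFf j x hj]
  rw [this]
  refine MeasurableSet.iUnion fun i => (hA i).inter ?_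
  obtain ⟨K, hK⟩ := (hf i).1
  exact (measurable_locLip hK.continuous).ennreal_toReal hs

theorem memLp_add {p : ℝ≥0∞} {m : Measure M} {F G : M → M → ℝ} (hF : IsPiecewise p m F)
    (hG : IsPiecewise p m G) (hFG : IsPiecewise p m (F + G))
    (h1 : MemLp (preNorm F) p m) (h2 : MemLp (preNorm G) p m) :
    MemLp (preNorm (F + G)) p m := by
  refine (h1.add h2).mono hFG.measurable_preNorm.aestronglyMeasurable
    (Eventually.of_forall fun x => ?_)
  rw [Real.norm_of_nonneg (preNorm_nonneg _ _)]
  exact (preNorm_add_le hF hG x).trans (le_abs_self _)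

theorem lipDomain_add {p : ℝ≥0∞} {m : Measure M} {f g : M → ℝ} (hf : f ∈ lipDomain p m)
    (hg : g ∈ lipDomain p m) : f + g ∈ lipDomain p m := by
  obtain ⟨⟨K, hK⟩, hf2⟩ := hf
  obtain ⟨⟨L, hL⟩, hg2⟩ := hg
  refine ⟨⟨K + L, hK.add hL⟩, (hf2.add hg2).mono
    (measurable_locLip (hK.add hL).continuous).ennreal_toReal.aestronglyMeasurable
    (Eventually.of_forall fun x => ?_)⟩
  have hf' := ne_top_of_le_ne_top ENNReal.coe_ne_top (locLip_le hK x)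
  have hg' := ne_top_of_le_ne_top ENNReal.coe_ne_top (locLip_le hL x)
  rw [Real.norm_of_nonneg ENNReal.toReal_nonneg]
  refine le_trans ?_ (le_abs_self _)
  simp only [Pi.add_apply]
  rw [← ENNReal.toReal_add hf' hg']
  exact ENNReal.toReal_mono (ENNReal.add_ne_top.2 ⟨hf', hg'⟩) (locLip_add_le _ _ _)


theorem IsPiecewise.add {p : ℝ≥0∞} {m : Measure M} {F G : M → M → ℝ} (hF : IsPiecewise p m F)
    (hG : IsPiecewise p m G) : IsPiecewise p m (F + G) := by
  obtain ⟨A, f, hA, hAd, hAU, hf, hFf⟩ := hF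
  obtain ⟨B, g, hB, hBd, hBU, hg, hGg⟩ := hG
  refine ⟨fun k => A k.unpair.1 ∩ B k.unpair.2, fun k => f k.unpair.1 + g k.unpair.2,
    fun k => (hA _).inter (hB _), ?_, ?_, fun k => lipDomain_add (hf _) (hg _), ?_⟩
  · intro i j hij
    have : i.unpair.1 ≠ j.unpair.1 ∨ i.unpair.2 ≠ j.unpair.2 := by
      by_contra! h
      apply hij
      rw [← Nat.pair_unpair i, ← Nat.pair_unpair j, h.1, h.2]
    rcases this with h | h
    · exact (hAd h).mono Set.inter_subset_left Set.inter_subset_left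
    · exact (hBd h).mono Set.inter_subset_right Set.inter_subset_right
  · refine Set.eq_univ_of_forall fun x => ?_
    obtain ⟨i, hi⟩ := Set.mem_iUnion.1 (hAU.symm ▸ Set.mem_univ x : x ∈ ⋃ i, A i)
    obtain ⟨j, hj⟩ := Set.mem_iUnion.1 (hBU.symm ▸ Set.mem_univ x : x ∈ ⋃ i, B i)
    exact Set.mem_iUnion.2 ⟨Nat.pair i j, by simpa using ⟨hi, hj⟩⟩
  · rintro k x ⟨h1, h2⟩
    simp only [Pi.add_apply]
    rw [hFf _ x h1, hGg _ x h2]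

/-- The set `Pfm` of families `(f i, A i)` with `∑ i, ∫_{A i} (lip (f i)) ^ p dm < ∞`,
as a vector space. -/
def pfmSubmodule (p : ℝ≥0∞) (m : Measure M) : Submodule ℝ (M → M → ℝ) where
  carrier := {F | IsPiecewise p m F ∧ MemLp (preNorm F) p m}
  add_mem' := fun hF hG => ⟨hF.1.add hG.1, memLp_add hF.1 hG.1 (hF.1.add hG.1) hF.2 hG.2⟩
  zero_mem' := by
    refine ⟨IsPiecewise.zero, ?_⟩
    have : preNorm (0 : M → M → ℝ) = 0 := by
      funext x
      simp [preNorm, locLip_zero]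
    rw [this]
    exact MemLp.zero
  smul_mem' := by
    rintro c F ⟨h1, h2⟩
    refine ⟨h1.smul c, ?_⟩
    have : preNorm (c • F) = fun x => |c| * preNorm F x := funext fun x => preNorm_smul c F x
    rw [this]
    exact h2.const_mul _

/-- `Pfm` as a type of its own; its topology comes from the seminorm below. -/
def Pfm (p : ℝ≥0∞) (m : Measure M) : Type _ := pfmSubmodule p m

instance (p : ℝ≥0∞) (m : Measure M) : AddCommGroup (Pfm p m) :=
  inferInstanceAs (AddCommGroup (pfmSubmodule p m))

instance (p : ℝ≥0∞) (m : Measure M) : Module ℝ (Pfm p m) :=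
  inferInstanceAs (Module ℝ (pfmSubmodule p m))

variable {p : ℝ≥0∞} {m : Measure M}

/-- The map `x ↦ f i` on `A i` that encodes an element of `Pfm`. -/
def Pfm.toFun (F : Pfm p m) : M → M → ℝ := F.1

theorem Pfm.toFun_add (F G : Pfm p m) : (F + G).toFun = F.toFun + G.toFun := rfl

theorem Pfm.toFun_smul (c : ℝ) (F : Pfm p m) : (c • F).toFun = c • F.toFun := rfl

theorem Pfm.isPiecewise (F : Pfm p m) : IsPiecewise p m F.toFun := F.2.1

theorem Pfm.memLp (F : Pfm p m) : MemLp (preNorm F.toFun) p m := F.2.2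

/-- The pointwise norm of an element of `Pfm`: the class of `lip (f i)` on `A i`. -/
def Pfm.pnorm (F : Pfm p m) : Lp ℝ p m := F.memLp.toLp _

theorem Pfm.coeFn_pnorm (F : Pfm p m) : F.pnorm =ᵐ[m] preNorm F.toFun := F.memLp.coeFn_toLp

variable [Fact (1 ≤ p)]

theorem Pfm.norm_pnorm_smul (c : ℝ) (F : Pfm p m) : ‖(c • F).pnorm‖ = ‖c‖ * ‖F.pnorm‖ := by
  have : (c • F).pnorm = |c| • F.pnorm := by
    apply Lp.ext
    filter_upwards [(c • F).coeFn_pnorm, F.coeFn_pnorm, Lp.coeFn_smul |c| F.pnorm] with x h1 h2 h3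
    rw [h1, h3, Pi.smul_apply, h2, Pfm.toFun_smul, preNorm_smul, smul_eq_mul]
  rw [this, norm_smul, Real.norm_eq_abs, Real.norm_eq_abs, abs_abs]

theorem Pfm.norm_pnorm_add_le (F G : Pfm p m) :
    ‖(F + G).pnorm‖ ≤ ‖F.pnorm‖ + ‖G.pnorm‖ := by
  refine le_trans (Lp.norm_le_norm_of_ae_le ?_) (norm_add_le F.pnorm G.pnorm)
  filter_upwards [(F + G).coeFn_pnorm, F.coeFn_pnorm, G.coeFn_pnorm,
    Lp.coeFn_add F.pnorm G.pnorm] with x h1 h2 h3 h4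
  rw [h1, h4, Pi.add_apply, h2, h3, Pfm.toFun_add, Real.norm_of_nonneg (preNorm_nonneg _ _)]
  exact (preNorm_add_le F.isPiecewise G.isPiecewise x).trans (le_abs_self _)

/-- The seminorm `‖F‖ = ‖|F|‖_{L^p}` on `Pfm`. -/
def pfmSeminorm (p : ℝ≥0∞) (m : Measure M) [Fact (1 ≤ p)] : Seminorm ℝ (Pfm p m) :=
  Seminorm.of (fun F => ‖F.pnorm‖) Pfm.norm_pnorm_add_le Pfm.norm_pnorm_smul

instance (p : ℝ≥0∞) (m : Measure M) [Fact (1 ≤ p)] : SeminormedAddCommGroup (Pfm p m) :=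
  (pfmSeminorm p m).toAddGroupSeminorm.toSeminormedAddCommGroup

theorem Pfm.norm_def (F : Pfm p m) : ‖F‖ = ‖F.pnorm‖ := rfl

instance (p : ℝ≥0∞) (m : Measure M) [Fact (1 ≤ p)] : NormedSpace ℝ (Pfm p m) where
  norm_smul_le c F := (Pfm.norm_pnorm_smul c F).le

/-- The `L^p`-Lipschitz module `L^p_lip(T^*M)`: the (Hausdorff) completion of `Pfm`, in which
`F` and `G` are identified if `|F - G| = 0` almost everywhere. -/
abbrev LipModule (p : ℝ≥0∞) (m : Measure M) [Fact (1 ≤ p)] : Type _ :=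
  UniformSpace.Completion (Pfm p m)

/-- The pointwise norm `v ↦ |v|` from the `L^p`-Lipschitz module to `L^p(m)`, the continuous
extension of the pointwise norm on `Pfm`. -/
def LipModule.pnorm (v : LipModule p m) : Lp ℝ p m :=
  UniformSpace.Completion.extension (fun F : Pfm p m => F.pnorm) v

theorem Pfm.lipschitzWith_pnorm : LipschitzWith 1 (fun F : Pfm p m => F.pnorm) := by
  refine LipschitzWith.of_dist_le_mul fun F G => ?_
  rw [NNReal.coe_one, one_mul, dist_eq_norm, dist_eq_norm, Pfm.norm_def]
  refine Lp.norm_le_norm_of_ae_le ?_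
  filter_upwards [F.coeFn_pnorm, G.coeFn_pnorm, (F - G).coeFn_pnorm,
    Lp.coeFn_sub F.pnorm G.pnorm] with x h1 h2 h3 h4
  rw [h4, Pi.sub_apply, h1, h2, h3, Real.norm_of_nonneg (preNorm_nonneg _ _), Real.norm_eq_abs,
    abs_le]
  have a1 := preNorm_add_le (F - G).isPiecewise G.isPiecewise x
  have a2 := preNorm_add_le (G - F).isPiecewise F.isPiecewise x
  have a3 : preNorm (G - F).toFun x = preNorm (F - G).toFun x := by
    have := preNorm_smul (-1) (F - G).toFun x
    rw [← Pfm.toFun_smul, neg_one_smul, neg_sub] at this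
    simpa using this
  rw [← Pfm.toFun_add, sub_add_cancel] at a1 a2
  constructor <;> linarith

theorem LipModule.pnorm_coe (F : Pfm p m) : LipModule.pnorm (F : LipModule p m) = F.pnorm :=
  UniformSpace.Completion.extension_coe Pfm.lipschitzWith_pnorm.uniformContinuous F

theorem LipModule.continuous_pnorm : Continuous (LipModule.pnorm : LipModule p m → Lp ℝ p m) :=
  UniformSpace.Completion.continuous_extension

/-- A set `S` of elements of the module is locally independent on `A` if for finitely many
distinct `v ∈ S` and almost every `x ∈ A` the map `c ↦ |∑ v, c v • v|_x` is a norm.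
The seminorm `ρ x` is the pointwise version of the classes `|∑ v, c v • v| ∈ L^p(m)`; it is
determined by them for almost every `x`. -/
def LocallyIndependent (S : Set (LipModule p m)) (A : Set M) : Prop :=
  ∀ T : Finset (LipModule p m), (T : Set (LipModule p m)) ⊆ S →
    ∃ ρ : M → Seminorm ℝ (T → ℝ),
      (∀ c : T → ℝ, (LipModule.pnorm (∑ v : T, c v • (v : LipModule p m)) : M → ℝ)
        =ᵐ[m] fun x => ρ x c) ∧
      ∀ᵐ x ∂m, x ∈ A → ∀ c : T → ℝ, ρ x c = 0 → c = 0

/-- `{v ≠ 0} ⊆ A` up to a null set. -/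
def SupportedOn (v : LipModule p m) (A : Set M) : Prop :=
  ∀ᵐ x ∂m, x ∉ A → (v.pnorm : M → ℝ) x = 0

/-- `S` is a maximal independent set on `A` among the sets of elements that vanish almost
everywhere outside `A`. -/
def IsMaximalIndependent (S : Set (LipModule p m)) (A : Set M) : Prop :=
  Maximal (fun S' : Set (LipModule p m) =>
    LocallyIndependent S' A ∧ ∀ v ∈ S', SupportedOn v A) S

/-- The `L^p`-Lipschitz module has local finite dimension bounded by `N`: there is a Borel
partition `(E n)`, `n ∈ ℕ ∪ {∞}`, with `E ∞` null, such that for every finite `n` each maximal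
independent set on each non-null Borel subset of `E n` has cardinality `n`, and `E n` is null
for `n > N`. -/
def LipModuleLocallyFiniteDimensional (p : ℝ≥0∞) [Fact (1 ≤ p)] (m : Measure M) (N : ℕ) : Prop :=
  ∃ E : ℕ∞ → Set M, (∀ n, MeasurableSet (E n)) ∧
    Pairwise (fun i j => Disjoint (E i) (E j)) ∧ (⋃ n, E n) = Set.univ ∧ m (E ⊤) = 0 ∧
    (∀ n : ℕ, ∀ A ⊆ E n, MeasurableSet A → m A ≠ 0 →
      ∀ S : Set (LipModule p m), IsMaximalIndependent S A → S.encard = n) ∧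
    ∀ n : ℕ, N < n → m (E n) = 0

/-- Functions `f 1, …, f n` are independent on `A` if for almost every `x ∈ A` the map
`c ↦ lip (∑ i, c i • f i) (x)` is a norm. -/
def LipIndependent (m : Measure M) {n : ℕ} (f : Fin n → M → ℝ) (A : Set M) : Prop :=
  ∀ᵐ x ∂m, x ∈ A → ∀ c : Fin n → ℝ, locLip (∑ i, c i • f i) x = 0 → c = 0

/-- `(M, d, m)` is a Lipschitz differentiability space with constant `N`: at most `N` Lipschitz
functions can be independent on a Borel set of positive measure. -/
def IsLipschitzDifferentiabilitySpace (m : Measure M) (N : ℕ) : Prop :=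
  ∀ (n : ℕ) (f : Fin n → M → ℝ), (∀ i, ∃ K : ℝ≥0, LipschitzWith K (f i)) →
    ∀ A : Set M, MeasurableSet A → m A ≠ 0 → LipIndependent m f A → n ≤ N

end LipMod

end

/-!
At each point `x` let `T*ₓM` be the completion of the Lipschitz functions for the seminorm
`lip · (x)`. An element `v` of the module has values `v(x) ∈ T*ₓM`, obtained as almost everywhere
limits along approximating families in `Pfm`, with `|v|ₓ = ‖v(x)‖`; hence independence on `A`, of
Lipschitz functions as well as of module elements, is linear independence in `T*ₓM` for almost every
`x ∈ A`.

Linear independence is an open condition, so `n` independent elements of the module stay independent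
after approximation, and their approximations restrict to `n` independent Lipschitz functions on a
smaller non-null set. Conversely, on a set covered by countably many charts with `n` independent
Lipschitz functions, fewer than `n` elements of the module cannot span these differentials, and
rescaled cut-offs of functions with differential outside the span glue to one more independent
element. The cardinality of a maximal independent set is therefore the largest `n` for which such
charts cover the set, and both properties bound this `n` by `N`.
-/

noncomputable section

namespace LipMod

section Preliminaries

theorem linearIndependent_iff_exists_nat_norm_le {ι E : Type*} [Fintype ι]
    [NormedAddCommGroup E] [NormedSpace ℝ E] {v : ι → E} :
    LinearIndependent ℝ v ↔
      ∃ n : ℕ, ∀ q : ι → ℚ, ‖fun i => (q i : ℝ)‖ ≤ n * ‖∑ i, (q i : ℝ) • v i‖ := by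
  constructor
  · intro hv
    obtain ⟨K, -, hK⟩ := (Fintype.linearCombination ℝ v).injective_iff_antilipschitz.1
      (LinearIndependent.fintypeLinearCombination_injective hv)
    obtain ⟨n, hn⟩ := exists_nat_ge (K : ℝ)
    refine ⟨n, fun q => (hK.le_mul_norm (map_zero _) _).trans ?_⟩
    exact mul_le_mul_of_nonneg_right hn (norm_nonneg _)
  · rintro ⟨n, hn⟩
    have hreal (c : ι → ℝ) : ‖c‖ ≤ n * ‖∑ i, c i • v i‖ :=
      (DenseRange.piMap fun _ : ι => Rat.denseRange_cast (𝕜 := ℝ)).induction_on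
        (p := fun c => ‖c‖ ≤ n * ‖∑ i, c i • v i‖) c
        (isClosed_le (by fun_prop) (by fun_prop)) hn
    refine Fintype.linearIndependent_iff.2 fun c hc => congrFun (norm_le_zero_iff.1 ?_)
    simpa [hc] using hreal c

theorem exists_notMem_span_of_card_lt {R E ι κ : Type*} [Semiring R] [StrongRankCondition R]
    [AddCommMonoid E] [Module R E] [Fintype ι] [Fintype κ] {v : ι → E} {w : κ → E}
    (hw : LinearIndependent R w) (hcard : Fintype.card ι < Fintype.card κ) :
    ∃ k, w k ∉ Submodule.span R (Set.range v) := by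
  classical
  by_contra! h
  have hle := linearIndependent_le_span_aux' w hw (Set.range v) (Set.range_subset_iff.2 h)
  exact hcard.not_ge
    (hle.trans (Fintype.card_le_of_surjective _ Set.rangeFactorization_surjective))

theorem exists_countable_subset_ae_cover {α : Type*} [MeasurableSpace α] (m : Measure α)
    [SFinite m] (C : Set (Set α)) (hC : ∀ s ∈ C, MeasurableSet s) :
    ∃ D ⊆ C, D.Countable ∧ ∀ s ∈ C, m (s \ ⋃₀ D) = 0 := by
  set ν := m.toFinite
  set unionMeasures : Set ℝ≥0∞ := (fun D => ν (⋃₀ D)) '' {D | D ⊆ C ∧ D.Countable}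
  obtain ⟨u, -, hu_lim, hu⟩ := exists_seq_tendsto_sSup
    (⟨_, ∅, by simp, rfl⟩ : unionMeasures.Nonempty) (OrderTop.bddAbove _)
  choose D hD hDu using hu
  have hsubset : ⋃ k, D k ⊆ C := Set.iUnion_subset fun k => (hD k).1
  have hcountable : (⋃ k, D k).Countable := Set.countable_iUnion fun k => (hD k).2
  refine ⟨⋃ k, D k, hsubset, hcountable, fun s hs => absolutelyContinuous_toFinite m ?_⟩
  have hmeas : MeasurableSet (⋃₀ ⋃ k, D k) :=
    .sUnion hcountable fun t ht => hC t (hsubset ht)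
  have hmax : ν (⋃₀ insert s (⋃ k, D k)) ≤ ν (⋃₀ ⋃ k, D k) :=
    calc ν (⋃₀ insert s (⋃ k, D k)) ≤ sSup unionMeasures :=
          le_sSup ⟨_, ⟨Set.insert_subset hs hsubset, hcountable.insert s⟩, rfl⟩
      _ ≤ ν (⋃₀ ⋃ k, D k) := le_of_tendsto' hu_lim fun k => (hDu k).symm.trans_le
          (measure_mono (Set.sUnion_subset_sUnion (Set.subset_iUnion D k)))
  rw [Set.sUnion_insert, ← Set.sdiff_union_self, measure_union Set.disjoint_sdiff_left hmeas]
    at hmax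
  exact le_zero_iff.1
    ((ENNReal.add_le_add_iff_right (measure_ne_top ν _)).1 (hmax.trans_eq (zero_add _).symm))

theorem exists_pos_abs_smul_le {ι E : Type*} [Countable ι] [NormedAddCommGroup E] [Lattice E]
    [HasSolidNorm E] [IsOrderedAddMonoid E] [NormedSpace ℝ E] [CompleteSpace E] (u : ι → E) :
    ∃ h : E, ∃ ε : ι → ℝ, (∀ i, 0 < ε i) ∧ ∀ i, |ε i • u i| ≤ h := by
  obtain ⟨δ, hδ, _, hδ_sum, -⟩ := NNReal.exists_pos_sum_of_countable one_ne_zero ι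
  have hpos (i : ι) : 0 < ‖u i‖ + 1 := by positivity
  have hsum : Summable fun i => |((δ i : ℝ) / (‖u i‖ + 1)) • u i| :=
    (NNReal.summable_coe.2 hδ_sum.summable).of_norm_bounded fun i => by
      rw [norm_abs_eq_norm, norm_smul, Real.norm_of_nonneg (by positivity), div_mul_eq_mul_div,
        div_le_iff₀ (hpos i)]
      gcongr
      simp
  exact ⟨_, _, fun i => div_pos (hδ i) (hpos i), fun i => hsum.le_tsum i fun j _ => abs_nonneg _⟩

/-- The supremum in `ℕ ∪ {∞}` of the indices `n` with `x ∈ U n`; it is `0` if there are none. -/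
def maxIndex {α : Type*} (U : ℕ → Set α) (x : α) : ℕ∞ :=
  ⨆ n, (U n).indicator (fun _ => (n : ℕ∞)) x

variable {α : Type*} {U : ℕ → Set α} {x : α}

theorem lt_maxIndex_iff {a : ℕ∞} : a < maxIndex U x ↔ ∃ n : ℕ, x ∈ U n ∧ a < n := by
  rw [maxIndex, lt_iSup_iff]
  refine exists_congr fun n => ?_
  by_cases hx : x ∈ U n <;> simp [hx]

theorem natCast_le_maxIndex {n : ℕ} (hx : x ∈ U n) : (n : ℕ∞) ≤ maxIndex U x :=
  le_iSup_of_le n (by rw [Set.indicator_of_mem hx])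

theorem mem_of_maxIndex_eq {n : ℕ} (hn : n ≠ 0) (hx : maxIndex U x = n) : x ∈ U n := by
  obtain ⟨k, hk, hnk⟩ : ∃ k : ℕ, x ∈ U k ∧ ((n - 1 : ℕ) : ℕ∞) < k :=
    lt_maxIndex_iff.1 (by rw [hx]; exact_mod_cast (by omega))
  have hkn : (k : ℕ∞) ≤ n := hx ▸ natCast_le_maxIndex hk
  norm_cast at hnk hkn
  rwa [show n = k by omega]

theorem measurable_maxIndex [MeasurableSpace α] (hU : ∀ n, MeasurableSet (U n)) :
    Measurable (maxIndex U) := by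
  have : BorelSpace ℕ∞ := ⟨borel_eq_top_of_countable.symm⟩
  exact .iSup fun n => measurable_const.indicator (hU n)

end Preliminaries

section CotangentSpace

variable {M : Type*} [MetricSpace M] {x : M} {f g : M → ℝ}

theorem locLip_congr (h : f =ᶠ[𝓝 x] g) : locLip f x = locLip g x := by
  refine limsup_congr ?_
  filter_upwards [h.filter_mono nhdsWithin_le_nhds] with y hy
  rw [hy, h.eq_of_nhds]

variable (M) in
/-- The real vector space of Lipschitz functions on `M`, with arbitrary Lipschitz constants. -/
def lipschitzFunctions : Submodule ℝ (M → ℝ) where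
  carrier := {f | ∃ K : ℝ≥0, LipschitzWith K f}
  add_mem' := fun ⟨K, hK⟩ ⟨L, hL⟩ => ⟨K + L, hK.add hL⟩
  zero_mem' := ⟨0, LipschitzWith.const 0⟩
  smul_mem' := fun c _ ⟨K, hK⟩ => ⟨‖c‖₊ * K, (lipschitzWith_smul c).comp hK⟩

theorem locLip_ne_top (hf : f ∈ lipschitzFunctions M) (x : M) : locLip f x ≠ ∞ :=
  let ⟨_, hK⟩ := hf
  ne_top_of_le_ne_top ENNReal.coe_ne_top (locLip_le hK x)

/-- The Lipschitz functions on `M`, as a type of its own to carry the seminorm `lip · (x)`. -/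
def LipGerm (_x : M) : Type _ := lipschitzFunctions M

instance (x : M) : AddCommGroup (LipGerm x) := inferInstanceAs (AddCommGroup (lipschitzFunctions M))

instance (x : M) : Module ℝ (LipGerm x) := inferInstanceAs (Module ℝ (lipschitzFunctions M))

/-- The seminorm `f ↦ lip f (x)` on Lipschitz functions. -/
def locLipSeminorm (x : M) : Seminorm ℝ (LipGerm x) :=
  Seminorm.of (fun f => (locLip f.1 x).toReal)
    (fun f g => by
      have hf := locLip_ne_top f.2 x
      have hg := locLip_ne_top g.2 x
      rw [← ENNReal.toReal_add hf hg]
      exact ENNReal.toReal_mono (ENNReal.add_ne_top.2 ⟨hf, hg⟩) (locLip_add_le _ _ _))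
    (fun c f => by
      rw [← toReal_enorm c, ← ENNReal.toReal_mul, ← locLip_smul]
      rfl)

instance (x : M) : SeminormedAddCommGroup (LipGerm x) :=
  (locLipSeminorm x).toAddGroupSeminorm.toSeminormedAddCommGroup

instance (x : M) : NormedSpace ℝ (LipGerm x) where
  norm_smul_le c f := (map_smul_eq_mul (locLipSeminorm x) c f).le

/-- The cotangent space `T*ₓM`: the completion of the Lipschitz functions modulo those with
`lip f (x) = 0`, normed by `lip · (x)`. -/
abbrev CotangentSpace (x : M) : Type _ := UniformSpace.Completion (LipGerm x)

/-- The differential `dₓf ∈ T*ₓM` of a Lipschitz function `f`. -/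
def differential (x : M) : lipschitzFunctions M →ₗ[ℝ] CotangentSpace x :=
  (UniformSpace.Completion.toComplL (𝕜 := ℝ) (E := LipGerm x)).toLinearMap

theorem norm_differential (x : M) (f : lipschitzFunctions M) :
    ‖differential x f‖ = (locLip f.1 x).toReal :=
  UniformSpace.Completion.norm_coe (E := LipGerm x) f

theorem differential_congr {f g : lipschitzFunctions M} (h : f.1 =ᶠ[𝓝 x] g.1) :
    differential x f = differential x g := by
  have hsub : locLip (f - g).1 x = locLip (0 : M → ℝ) x :=
    locLip_congr (h.mono fun y hy => sub_eq_zero.2 hy)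
  rw [← sub_eq_zero, ← map_sub, ← norm_eq_zero, norm_differential, hsub, locLip_zero,
    ENNReal.toReal_zero]

theorem exists_isBounded_support_eqOn_ball (hf : f ∈ lipschitzFunctions M) (x₀ : M)
    (R : ℝ) : ∃ g ∈ lipschitzFunctions M, Bornology.IsBounded (Function.support g) ∧
      Set.EqOn f g (Metric.ball x₀ R) := by
  obtain ⟨K, hK⟩ := hf
  set L : ℝ := |f x₀| + K * R + R
  -- `f` is truncated between `-h` and `h`, where `h` dominates `|f|` on the ball.
  set h : M → ℝ := fun x => max 0 (L - dist x x₀)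
  have hh : LipschitzWith 1 h := by
    simpa using ((LipschitzWith.const L).sub (LipschitzWith.dist_left x₀)).const_max 0
  refine ⟨fun x => max (min (f x) (h x)) (-h x), ⟨_, (hK.min hh).max hh.neg⟩,
    (Metric.isBounded_closedBall (x := x₀) (r := L)).subset fun x hx => ?_, fun x hx => ?_⟩
  · by_contra hxL
    have hhx : h x = 0 := max_eq_left (sub_nonpos.2 (not_le.1 hxL).le)
    simp [hhx] at hx
  · have hfx : |f x| ≤ h x := by
      have hdist : dist x x₀ < R := hx
      have hLip : |f x - f x₀| ≤ K * R :=
        (hK.dist_le_mul x x₀).trans (by gcongr)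
      exact le_max_of_le_right (by linarith [abs_sub_abs_le_abs_sub (f x) (f x₀)])
    rw [abs_le] at hfx
    simp only [min_eq_left hfx.2, max_eq_left hfx.1]

end CotangentSpace

section PfmValue

variable {M : Type*} [MetricSpace M] [MeasurableSpace M] [BorelSpace M] {p : ℝ≥0∞} {m : Measure M}

theorem Pfm.toFun_mem (F : Pfm p m) (x : M) : F.toFun x ∈ lipschitzFunctions M := by
  obtain ⟨A, f, -, -, hAU, hf, hFf⟩ := F.isPiecewise
  obtain ⟨i, hi⟩ := Set.mem_iUnion.1 (hAU.symm ▸ Set.mem_univ x)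
  exact hFf i x hi ▸ (hf i).1

/-- The value at `x` of a piecewise Lipschitz function, `(fᵢ, Aᵢ)ᵢ ↦ dₓfᵢ` if `x ∈ Aᵢ`. -/
def Pfm.valueAt (x : M) : Pfm p m →ₗ[ℝ] CotangentSpace x :=
  differential x ∘ₗ LinearMap.codRestrict (lipschitzFunctions M)
    (LinearMap.proj x ∘ₗ (pfmSubmodule p m).subtype) fun F => Pfm.toFun_mem F x

theorem Pfm.norm_valueAt (x : M) (F : Pfm p m) : ‖F.valueAt x‖ = preNorm F.toFun x :=
  norm_differential x _

theorem Pfm.pnorm_smul (c : ℝ) (F : Pfm p m) : (c • F).pnorm = |c| • F.pnorm := by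
  apply Lp.ext
  filter_upwards [(c • F).coeFn_pnorm, F.coeFn_pnorm, Lp.coeFn_smul |c| F.pnorm]
    with x hcF hF hsmul
  rw [hcF, hsmul, Pi.smul_apply, hF, Pfm.toFun_smul, preNorm_smul, smul_eq_mul]

end PfmValue

section ModuleValue

variable {M : Type*} [MetricSpace M] [MeasurableSpace M] [BorelSpace M] {p : ℝ≥0∞} {m : Measure M}
  [Fact (1 ≤ p)]

theorem Pfm.ae_pnorm_coe_sub (F G : Pfm p m) :
    ∀ᵐ x ∂m, LipModule.pnorm (F - G : LipModule p m) x = ‖F.valueAt x - G.valueAt x‖ := by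
  rw [← UniformSpace.Completion.coe_sub, LipModule.pnorm_coe]
  filter_upwards [(F - G).coeFn_pnorm] with x hx
  rw [hx, ← map_sub, Pfm.norm_valueAt]

namespace LipModule

theorem pnorm_zero : (0 : LipModule p m).pnorm = 0 := by
  rw [← UniformSpace.Completion.coe_zero, pnorm_coe, ← norm_eq_zero, ← Pfm.norm_def, norm_zero]

theorem ae_pnorm_smul (c : ℝ) (v : LipModule p m) :
    ∀ᵐ x ∂m, (c • v).pnorm x = |c| * v.pnorm x := by
  have hsmul : (c • v).pnorm = |c| • v.pnorm := by
    induction v using UniformSpace.Completion.induction_on with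
    | hp =>
      exact isClosed_eq (continuous_pnorm.comp (continuous_const_smul c))
        (continuous_pnorm.const_smul |c|)
    | ih F =>
      rw [← UniformSpace.Completion.coe_smul, pnorm_coe, pnorm_coe, Pfm.pnorm_smul]
  rw [hsmul]
  exact Lp.coeFn_smul |c| v.pnorm

theorem ae_abs_pnorm_sub_pnorm_le (v w : LipModule p m) :
    ∀ᵐ x ∂m, |v.pnorm x - w.pnorm x| ≤ (v - w).pnorm x := by
  have hle : |v.pnorm - w.pnorm| ≤ (v - w).pnorm := by
    induction v, w using UniformSpace.Completion.induction_on₂ with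
    | hp =>
      have hfst := continuous_pnorm.comp (continuous_fst (X := LipModule p m) (Y := LipModule p m))
      have hsnd := continuous_pnorm.comp (continuous_snd (X := LipModule p m) (Y := LipModule p m))
      exact isClosed_le ((hfst.sub hsnd).sup (hfst.sub hsnd).neg)
        (continuous_pnorm.comp continuous_sub)
    | ih F G =>
      rw [← Lp.coeFn_le]
      filter_upwards [F.coeFn_pnorm, G.coeFn_pnorm, F.ae_pnorm_coe_sub G,
        Lp.coeFn_abs (F.pnorm - G.pnorm), Lp.coeFn_sub F.pnorm G.pnorm] with x hF hG hFG habs hsub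
      rw [pnorm_coe, pnorm_coe, hFG, habs, hsub, Pi.sub_apply, hF, hG, ← Pfm.norm_valueAt,
        ← Pfm.norm_valueAt]
      exact abs_norm_sub_norm_le _ _
  filter_upwards [(Lp.coeFn_le _ _).2 hle, Lp.coeFn_abs (v.pnorm - w.pnorm),
    Lp.coeFn_sub v.pnorm w.pnorm] with x hx habs hsub
  rwa [habs, hsub] at hx

theorem exists_seq_tendsto_pnorm_sub (v : LipModule p m) :
    ∃ G : ℕ → Pfm p m, ∀ᵐ x ∂m,
      Tendsto (fun k => (v - (G k : LipModule p m)).pnorm x) atTop (𝓝 0) := by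
  obtain ⟨u, hu, hlim⟩ := mem_closure_iff_seq_limit.1
    (UniformSpace.Completion.denseRange_coe v : v ∈ closure (Set.range _))
  choose F hF using hu
  have hLp : Tendsto (fun k => (v - (F k : LipModule p m)).pnorm) atTop (𝓝 0) := by
    simp_rw [hF, ← pnorm_zero (p := p) (m := m)]
    exact (continuous_pnorm.tendsto _).comp (by simpa using hlim.const_sub v)
  obtain ⟨ns, -, hns⟩ := (tendstoInMeasure_of_tendsto_Lp hLp).exists_seq_tendsto_ae
  refine ⟨fun k => F (ns k), ?_⟩
  filter_upwards [hns, Lp.coeFn_zero ℝ p m] with x hx hzero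
  rwa [hzero] at hx

/-- A sequence of piecewise Lipschitz functions that converges to `v` in the pointwise norm almost
everywhere. -/
def approx (v : LipModule p m) : ℕ → Pfm p m := (exists_seq_tendsto_pnorm_sub v).choose

theorem ae_tendsto_pnorm_sub_approx (v : LipModule p m) :
    ∀ᵐ x ∂m, Tendsto (fun k => (v - (v.approx k : LipModule p m)).pnorm x) atTop (𝓝 0) :=
  (exists_seq_tendsto_pnorm_sub v).choose_spec

/-- The value `v(x) ∈ T*ₓM` of an element `v` of the Lipschitz module. Only its class up to almost
everywhere equality is meaningful; it is computed along the sequence `v.approx`. -/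
def value (v : LipModule p m) (x : M) : CotangentSpace x :=
  limUnder atTop fun k => (v.approx k).valueAt x

theorem ae_tendsto_valueAt_approx (v : LipModule p m) :
    ∀ᵐ x ∂m, Tendsto (fun k => (v.approx k).valueAt x) atTop (𝓝 (v.value x)) := by
  have hdist (k : ℕ × ℕ) := (v.approx k.1).ae_pnorm_coe_sub (v.approx k.2)
  have htriangle (k : ℕ × ℕ) := ae_abs_pnorm_sub_pnorm_le (v - (v.approx k.2 : LipModule p m))
    (v.approx k.1 - v.approx k.2)
  simp_rw [sub_sub_sub_cancel_right] at htriangle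
  filter_upwards [ae_tendsto_pnorm_sub_approx v, ae_all_iff.2 hdist, ae_all_iff.2 htriangle]
    with x hlim hdist htriangle
  refine CauchySeq.tendsto_limUnder (cauchySeq_iff_tendsto_dist_atTop_0.2 ?_)
  rw [← prod_atTop_atTop_eq]
  refine squeeze_zero (fun _ => dist_nonneg) (fun k => ?_)
    (add_zero (0 : ℝ) ▸ (hlim.comp tendsto_fst).add (hlim.comp tendsto_snd))
  rw [dist_eq_norm, ← hdist]
  simp only [Function.comp_apply]
  linarith [(abs_le.1 (htriangle k)).1]

theorem ae_norm_value_sub_valueAt (v : LipModule p m) (F : Pfm p m) :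
    ∀ᵐ x ∂m, ‖v.value x - F.valueAt x‖ = (v - F : LipModule p m).pnorm x := by
  have hnorm (k : ℕ) := (v.approx k).ae_pnorm_coe_sub F
  have htriangle (k : ℕ) := ae_abs_pnorm_sub_pnorm_le (v - (F : LipModule p m)) (v.approx k - F)
  simp_rw [sub_sub_sub_cancel_right] at htriangle
  filter_upwards [ae_tendsto_valueAt_approx v, ae_tendsto_pnorm_sub_approx v, ae_all_iff.2 hnorm,
    ae_all_iff.2 htriangle] with x hvalue hlim hnorm htriangle
  refine tendsto_nhds_unique (hvalue.sub_const _).norm ?_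
  simp_rw [← hnorm]
  rw [tendsto_iff_norm_sub_tendsto_zero]
  refine squeeze_zero (fun _ => norm_nonneg _) (fun k => ?_) hlim
  rw [norm_sub_rev, Real.norm_eq_abs]
  exact htriangle k

theorem ae_value_coe (F : Pfm p m) : ∀ᵐ x ∂m, value (F : LipModule p m) x = F.valueAt x := by
  have hsub := ae_norm_value_sub_valueAt (F : LipModule p m) F
  rw [sub_self, pnorm_zero] at hsub
  filter_upwards [hsub, Lp.coeFn_zero ℝ p m] with x hx hzero
  rw [← sub_eq_zero, ← norm_eq_zero, hx, hzero, Pi.zero_apply]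

theorem ae_norm_value (v : LipModule p m) : ∀ᵐ x ∂m, ‖v.value x‖ = v.pnorm x := by
  simpa [UniformSpace.Completion.coe_zero] using ae_norm_value_sub_valueAt v 0

theorem ae_value_eq_of_tendsto_pnorm {v : LipModule p m} {F : ℕ → Pfm p m}
    {a : (x : M) → CotangentSpace x}
    (hF : ∀ᵐ x ∂m, Tendsto (fun k => (v - (F k : LipModule p m)).pnorm x) atTop (𝓝 0))
    (ha : ∀ᵐ x ∂m, Tendsto (fun k => (F k).valueAt x) atTop (𝓝 (a x))) :
    ∀ᵐ x ∂m, v.value x = a x := by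
  filter_upwards [hF, ha, ae_all_iff.2 fun k => ae_norm_value_sub_valueAt v (F k)]
    with x hF ha hnorm
  simp_rw [← hnorm] at hF
  refine tendsto_nhds_unique ?_ ha
  rw [tendsto_iff_norm_sub_tendsto_zero]
  simpa only [norm_sub_rev] using hF

theorem ae_value_add (v w : LipModule p m) :
    ∀ᵐ x ∂m, (v + w).value x = v.value x + w.value x := by
  refine ae_value_eq_of_tendsto_pnorm (F := fun k => v.approx k + w.approx k) ?_ ?_
  · have htriangle (k : ℕ) := ae_abs_pnorm_sub_pnorm_le
      (v + w - ((v.approx k + w.approx k : Pfm p m) : LipModule p m)) (w - w.approx k)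
    have hsub (k : ℕ) : v + w - ((v.approx k + w.approx k : Pfm p m) : LipModule p m) -
        (w - w.approx k) = v - v.approx k := by
      rw [UniformSpace.Completion.coe_add]
      abel
    simp_rw [hsub] at htriangle
    filter_upwards [ae_tendsto_pnorm_sub_approx v, ae_tendsto_pnorm_sub_approx w,
      ae_all_iff.2 htriangle, ae_all_iff.2 fun k => ae_norm_value_sub_valueAt (v + w)
        (v.approx k + w.approx k)] with x hv hw htriangle hnorm
    refine squeeze_zero (fun k => hnorm k ▸ norm_nonneg _) (fun k => ?_) (by simpa using hv.add hw)
    linarith [(abs_le.1 (htriangle k)).2]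
  · filter_upwards [ae_tendsto_valueAt_approx v, ae_tendsto_valueAt_approx w] with x hv hw
    simpa only [map_add] using hv.add hw

theorem ae_value_smul (c : ℝ) (v : LipModule p m) :
    ∀ᵐ x ∂m, (c • v).value x = c • v.value x := by
  refine ae_value_eq_of_tendsto_pnorm (F := fun k => c • v.approx k) ?_ ?_
  · filter_upwards [ae_tendsto_pnorm_sub_approx v,
      ae_all_iff.2 fun k => ae_pnorm_smul c (v - (v.approx k : LipModule p m))] with x hv hsmul
    simp_rw [UniformSpace.Completion.coe_smul, ← smul_sub, hsmul]
    simpa using hv.const_mul |c|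
  · filter_upwards [ae_tendsto_valueAt_approx v] with x hv
    simpa only [map_smul] using hv.const_smul c

theorem ae_value_sum_smul {ι : Type*} (s : Finset ι) (c : ι → ℝ) (v : ι → LipModule p m) :
    ∀ᵐ x ∂m, (∑ i ∈ s, c i • v i).value x = ∑ i ∈ s, c i • (v i).value x := by
  classical
  induction s using Finset.induction_on with
  | empty => simpa [UniformSpace.Completion.coe_zero] using ae_value_coe (0 : Pfm p m)
  | insert i s hi ih =>
    simp_rw [Finset.sum_insert hi]
    filter_upwards [ih, ae_value_smul (c i) (v i), ae_value_add (c i • v i) (∑ j ∈ s, c j • v j)]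
      with x hsum hsmul hadd
    rw [hadd, hsmul, hsum]

theorem ae_norm_sum_smul_value {ι : Type*} [Fintype ι] (c : ι → ℝ) (v : ι → LipModule p m) :
    ∀ᵐ x ∂m, ‖∑ i, c i • (v i).value x‖ = (∑ i, c i • v i).pnorm x := by
  filter_upwards [ae_value_sum_smul Finset.univ c v, ae_norm_value (∑ i, c i • v i)]
    with x hsum hnorm
  rw [← hsum, hnorm]

theorem nullMeasurableSet_linearIndependent_value {ι : Type*} [Finite ι] (v : ι → LipModule p m) :
    NullMeasurableSet {x | LinearIndependent ℝ fun i => (v i).value x} m := by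
  cases nonempty_fintype ι
  have hmeas (q : ι → ℚ) : AEMeasurable (fun x => ‖∑ i, (q i : ℝ) • (v i).value x‖) m :=
    (Lp.aestronglyMeasurable (∑ i, (q i : ℝ) • v i).pnorm).aemeasurable.congr <| by
      filter_upwards [ae_norm_sum_smul_value (fun i => (q i : ℝ)) v] with x hx using hx.symm
  simp_rw [linearIndependent_iff_exists_nat_norm_le, Set.ofPred_exists, Set.ofPred_forall]
  exact .iUnion fun n => .iInter fun q =>
    nullMeasurableSet_le aemeasurable_const ((hmeas q).const_mul _)

end LipModule

theorem locallyIndependent_iff {S : Set (LipModule p m)} {A : Set M} :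
    LocallyIndependent S A ↔ ∀ T : Finset (LipModule p m), (T : Set (LipModule p m)) ⊆ S →
      ∀ᵐ x ∂m, x ∈ A → LinearIndependent ℝ fun v : T => v.1.value x := by
  refine forall₂_congr fun T _ => ⟨?_, fun h => ?_⟩
  · rintro ⟨ρ, hρ, hρ_norm⟩
    filter_upwards [hρ_norm, ae_all_iff.2 fun q : T → ℚ => hρ fun v => q v,
      ae_all_iff.2 fun q : T → ℚ => LipModule.ae_norm_sum_smul_value (fun v => (q v : ℝ))
        fun v : T => v.1] with x hx hρ_rat hsum hxA
    have hρ_cont : Continuous (ρ x) := (ρ x).convexOn.locallyLipschitz.continuous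
    have hρ_eq (c : T → ℝ) : ρ x c = ‖∑ v, c v • v.1.value x‖ :=
      (DenseRange.piMap fun _ : T => Rat.denseRange_cast (𝕜 := ℝ)).induction_on
        (p := fun c => ρ x c = ‖∑ v, c v • v.1.value x‖) c
        (isClosed_eq hρ_cont (by fun_prop)) fun q => (hρ_rat q).symm.trans (hsum q).symm
    refine Fintype.linearIndependent_iff.2 fun c hc => congrFun (hx hxA c ?_)
    rw [hρ_eq, hc, norm_zero]
  · refine ⟨fun x => (normSeminorm ℝ (CotangentSpace x)).comp
      (Fintype.linearCombination ℝ fun v : T => v.1.value x), fun c => ?_, ?_⟩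
    · filter_upwards [LipModule.ae_norm_sum_smul_value c fun v : T => v.1] with x hx
      exact hx.symm
    · filter_upwards [h] with x hx hxA c hc
      exact funext (Fintype.linearIndependent_iff.1 (hx hxA) c (norm_eq_zero.1 hc))

theorem exists_isMaximalIndependent (A : Set M) :
    ∃ S : Set (LipModule p m), IsMaximalIndependent S A := by
  have hempty : LocallyIndependent (∅ : Set (LipModule p m)) A :=
    locallyIndependent_iff.2 fun T hT => by
      obtain rfl : T = ∅ := by simpa using hT
      exact .of_forall fun x _ => linearIndependent_empty_type
  refine (zorn_subset_nonempty
    {S : Set (LipModule p m) | LocallyIndependent S A ∧ ∀ v ∈ S, SupportedOn v A}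
    (fun c hc hchain hne => ?_) ∅ ⟨hempty, by simp⟩).imp fun S hS => hS.2
  refine ⟨⋃₀ c, ⟨fun T hT => ?_, ?_⟩, fun s hs => Set.subset_sUnion_of_mem hs⟩
  · obtain ⟨s, hs, hTs⟩ := DirectedOn.exists_mem_subset_of_finite_of_subset_sUnion hne
      hchain.directedOn T.finite_toSet hT
    exact (hc hs).1 T hTs
  · rintro v ⟨s, hs, hv⟩
    exact (hc hs).2 v hv

end ModuleValue

section Gluing

variable {M : Type*} [MetricSpace M] [MeasurableSpace M] {p : ℝ≥0∞} {m : Measure M}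

theorem sigmaFinite_of_isBounded (hm : ∀ s : Set M, Bornology.IsBounded s → m s < ∞) :
    SigmaFinite m := by
  rcases isEmpty_or_nonempty M with hM | ⟨⟨x₀⟩⟩
  · rw [m.eq_zero_of_isEmpty]
    infer_instance
  · exact ⟨⟨⟨fun n => Metric.ball x₀ n, fun _ => trivial, fun n => hm _ Metric.isBounded_ball,
      Metric.iUnion_ball_nat x₀⟩⟩⟩

theorem exists_isPiecewise_of_cover {ι : Type*} [Countable ι] {A : ι → Set M}
    (hA : ∀ i, MeasurableSet (A i)) (hcover : ∀ x, ∃ i, x ∈ A i) {f : ι → M → ℝ}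
    (hf : ∀ i, f i ∈ lipDomain p m) :
    ∃ F, IsPiecewise p m F ∧ ∀ x, ∃ i, x ∈ A i ∧ F x = f i := by
  rcases isEmpty_or_nonempty ι with hι | hι
  · exact ⟨0, .zero, fun x => isEmptyElim (hcover x).choose⟩
  obtain ⟨e, he⟩ := exists_surjective_nat ι
  have hcover' : ⋃ k, disjointed (A ∘ e) k = Set.univ := by
    rw [iUnion_disjointed]
    refine (he.iUnion_comp A).trans ?_
    exact Set.eq_univ_of_forall fun x => Set.mem_iUnion.2 (hcover x)
  choose k hk using fun x => Set.mem_iUnion.1 (hcover'.symm ▸ Set.mem_univ x)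
  refine ⟨fun x => f (e (k x)), ⟨disjointed (A ∘ e), f ∘ e, .disjointed fun _ => hA _,
    disjoint_disjointed _, hcover', fun _ => hf _, fun j x hx => ?_⟩,
    fun x => ⟨e (k x), disjointed_subset (A ∘ e) _ (hk x), rfl⟩⟩
  have hjk : k x = j := by
    by_contra hne
    exact Set.disjoint_left.1 (disjoint_disjointed _ hne) (hk x) hx
  simp only [hjk, Function.comp_apply]

variable [BorelSpace M]

theorem mem_lipDomain_of_measure_tsupport_ne_top {f : M → ℝ} (hf : f ∈ lipschitzFunctions M)
    (hsupp : m (tsupport f) ≠ ∞) : f ∈ lipDomain p m := by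
  obtain ⟨K, hK⟩ := hf
  refine ⟨⟨K, hK⟩, MemLp.mono (memLp_indicator_const p (isClosed_tsupport f).measurableSet
    (K : ℝ) (Or.inr hsupp)) (measurable_locLip hK.continuous).ennreal_toReal.aestronglyMeasurable
    (Eventually.of_forall fun x => ?_)⟩
  by_cases hx : x ∈ tsupport f
  · rw [Set.indicator_of_mem hx, Real.norm_of_nonneg ENNReal.toReal_nonneg, NNReal.norm_eq]
    exact ENNReal.toReal_mono ENNReal.coe_ne_top (locLip_le hK x)
  · rw [locLip_congr (notMem_tsupport_iff_eventuallyEq.1 hx), locLip_zero]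
    simp

theorem exists_pfm_valueAt_eq_differential (hm : ∀ s : Set M, Bornology.IsBounded s → m s < ∞)
    (f : lipschitzFunctions M) (x₀ : M) (R : ℝ) :
    ∃ F : Pfm p m, ∀ x ∈ Metric.ball x₀ R, F.valueAt x = differential x f := by
  obtain ⟨g, hg, hsupp, hfg⟩ := exists_isBounded_support_eqOn_ball f.2 x₀ R
  have hgdom : g ∈ lipDomain p m :=
    mem_lipDomain_of_measure_tsupport_ne_top hg (hm _ hsupp.closure).ne
  obtain ⟨F, hF, hFg⟩ := exists_isPiecewise_of_cover (ι := Unit) (fun _ => MeasurableSet.univ)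
    (fun x => ⟨(), Set.mem_univ x⟩) (fun _ => hgdom)
  obtain rfl : F = fun _ => g := funext fun x => (hFg x).choose_spec.2
  refine ⟨⟨_, hF, hgdom.2⟩, fun x hx => differential_congr ?_⟩
  filter_upwards [Metric.isOpen_ball.mem_nhds hx] with y hy using (hfg hy).symm

theorem Pfm.exists_valueAt_eq_of_cover {ι : Type*} [Countable ι] {A : ι → Set M}
    (hA : ∀ i, MeasurableSet (A i)) (hcover : ∀ x, ∃ i, x ∈ A i) (F : ι → Pfm p m)
    {h : Lp ℝ p m} (hF : ∀ i, (F i).pnorm ≤ h) :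
    ∃ G : Pfm p m, ∀ x, ∃ i, x ∈ A i ∧ G.valueAt x = (F i).valueAt x := by
  choose B f hB _ hBU hf hFf using fun i => (F i).isPiecewise
  have hcoverB (x : M) : ∃ i : ι × ℕ, x ∈ A i.1 ∩ B i.1 i.2 := by
    obtain ⟨i, hi⟩ := hcover x
    obtain ⟨k, hk⟩ := Set.mem_iUnion.1 (hBU i ▸ Set.mem_univ x)
    exact ⟨(i, k), hi, hk⟩
  obtain ⟨G, hG, hGf⟩ := exists_isPiecewise_of_cover (fun i : ι × ℕ => (hA i.1).inter (hB i.1 i.2))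
    hcoverB fun i => hf i.1 i.2
  have hGF (x : M) : ∃ i, x ∈ A i ∧ G x = (F i).toFun x := by
    obtain ⟨⟨i, k⟩, ⟨hxA, hxB⟩, hx⟩ := hGf x
    exact ⟨i, hxA, hx.trans (hFf i k x hxB).symm⟩
  have hmem : MemLp (preNorm G) p m := by
    refine (Lp.memLp h).mono hG.measurable_preNorm.aestronglyMeasurable ?_
    filter_upwards [ae_all_iff.2 fun i => (Lp.coeFn_le _ _).2 (hF i),
      ae_all_iff.2 fun i => (F i).coeFn_pnorm] with x hle hcoe
    obtain ⟨i, -, hx⟩ := hGF x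
    rw [Real.norm_of_nonneg (preNorm_nonneg _ _), preNorm, hx, ← preNorm, ← hcoe i]
    exact (hle i).trans (le_abs_self _)
  refine ⟨⟨G, hG, hmem⟩, fun x => ?_⟩
  obtain ⟨i, hxA, hx⟩ := hGF x
  exact ⟨i, hxA, congrArg (differential x) (Subtype.ext hx)⟩

variable [Fact (1 ≤ p)]

theorem supportedOn_coe {F : Pfm p m} {A : Set M} (h : ∀ x ∉ A, F.valueAt x = 0) :
    SupportedOn (F : LipModule p m) A := by
  rw [SupportedOn, LipModule.pnorm_coe]
  filter_upwards [F.coeFn_pnorm] with x hx hxA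
  rw [hx, ← Pfm.norm_valueAt, h x hxA, norm_zero]

end Gluing

section Charts

variable {M : Type*} [MetricSpace M] [MeasurableSpace M] {m : Measure M} {n : ℕ} {A : Set M}

theorem lipIndependent_iff {f : Fin n → lipschitzFunctions M} :
    LipIndependent m (fun i => (f i : M → ℝ)) A ↔
      ∀ᵐ x ∂m, x ∈ A → LinearIndependent ℝ fun i => differential x (f i) := by
  refine eventually_congr (.of_forall fun x => imp_congr_right fun _ => ?_)
  have hzero (c : Fin n → ℝ) :
      locLip (∑ i, c i • (f i : M → ℝ)) x = 0 ↔ ∑ i, c i • differential x (f i) = 0 := by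
    have hsum := norm_differential x (∑ i, c i • f i)
    simp only [map_sum, map_smul, Submodule.coe_sum, Submodule.coe_smul] at hsum
    have htop := locLip_ne_top (∑ i, c i • f i).2 x
    simp only [Submodule.coe_sum, Submodule.coe_smul] at htop
    rw [← norm_eq_zero, hsum, ENNReal.toReal_eq_zero_iff, or_iff_left htop]
  simp_rw [Fintype.linearIndependent_iff, hzero, funext_iff, Pi.zero_apply]

/-- A Lipschitz chart of dimension `n`: a Borel set on which some `n` Lipschitz functions have
linearly independent differentials almost everywhere. -/
def IsLipChart (m : Measure M) (n : ℕ) (A : Set M) : Prop :=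
  MeasurableSet A ∧ ∃ f : Fin n → lipschitzFunctions M,
    ∀ᵐ x ∂m, x ∈ A → LinearIndependent ℝ fun i => differential x (f i)

theorem IsLipChart.mono {B : Set M} (hA : IsLipChart m n A) (hB : MeasurableSet B)
    (hBA : B ⊆ A) : IsLipChart m n B :=
  ⟨hB, hA.2.imp fun _ hf => hf.mono fun _ hx hxB => hx (hBA hxB)⟩

theorem isLipschitzDifferentiabilitySpace_iff {N : ℕ} :
    IsLipschitzDifferentiabilitySpace m N ↔ ∀ n A, IsLipChart m n A → m A ≠ 0 → n ≤ N := by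
  refine forall_congr' fun n => ⟨?_, ?_⟩
  · rintro h A ⟨hA, f, hf⟩ hA0
    exact h (fun i => f i) (fun i => (f i).2) A hA hA0 (lipIndependent_iff.2 hf)
  · intro h f hf A hA hA0 hfA
    exact h A ⟨hA, fun i => ⟨f i, hf i⟩, lipIndependent_iff.1 hfA⟩ hA0

variable [BorelSpace M] {p : ℝ≥0∞}

theorem exists_isLipChart_of_linearIndependent_valueAt (hA : MeasurableSet A) (hA0 : m A ≠ 0)
    {F : Fin n → Pfm p m}
    (hF : ∀ᵐ x ∂m, x ∈ A → LinearIndependent ℝ fun i => (F i).valueAt x) :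
    ∃ B ⊆ A, m B ≠ 0 ∧ IsLipChart m n B := by
  choose P f hP _ hPU hf hFf using fun i => (F i).isPiecewise
  have hcover : A ⊆ ⋃ l : Fin n → ℕ, A ∩ ⋂ i, P i (l i) := fun x hx => by
    choose l hl using fun i => Set.mem_iUnion.1 (hPU i ▸ Set.mem_univ x)
    exact Set.mem_iUnion.2 ⟨l, hx, Set.mem_iInter.2 hl⟩
  obtain ⟨l, hl⟩ : ∃ l : Fin n → ℕ, m (A ∩ ⋂ i, P i (l i)) ≠ 0 := by
    by_contra! h
    exact hA0 (measure_mono_null hcover (measure_iUnion_null h))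
  refine ⟨_, Set.inter_subset_left, hl, hA.inter (.iInter fun i => hP i (l i)),
    fun i => ⟨f i (l i), (hf i (l i)).1⟩, ?_⟩
  filter_upwards [hF] with x hx ⟨hxA, hxP⟩
  convert hx hxA using 2 with i
  exact congrArg (differential x) (Subtype.ext (hFf i _ x (Set.mem_iInter.1 hxP i)).symm)

variable [Fact (1 ≤ p)]

theorem exists_isLipChart_of_linearIndependent_value (hA : MeasurableSet A) (hA0 : m A ≠ 0)
    {v : Fin n → LipModule p m}
    (hv : ∀ᵐ x ∂m, x ∈ A → LinearIndependent ℝ fun i => (v i).value x) :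
    ∃ B ⊆ A, m B ≠ 0 ∧ IsLipChart m n B := by
  choose I hI hI_meas hI_ae using fun k =>
    (LipModule.nullMeasurableSet_linearIndependent_value (m := m) fun i =>
      ((v i).approx k : LipModule p m)).exists_measurable_subset_ae_eq
  have hcover : ∀ᵐ x ∂m, x ∈ A → x ∈ ⋃ k, A ∩ I k := by
    filter_upwards [hv, ae_all_iff.2 fun i => LipModule.ae_tendsto_valueAt_approx (v i),
      ae_all_iff.2 fun i => ae_all_iff.2 fun k => LipModule.ae_value_coe ((v i).approx k),
      ae_all_iff.2 hI_ae] with x hx hlim hcoe hI hxA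
    -- Linear independence is an open condition, so it passes to a late enough approximation.
    obtain ⟨k, hk⟩ := ((tendsto_pi_nhds.2 hlim).eventually
      (isOpen_setOfPred_linearIndependent.mem_nhds (hx hxA))).exists
    refine Set.mem_iUnion.2 ⟨k, hxA, (hI k).mpr ?_⟩
    change LinearIndependent ℝ _
    simpa only [hcoe] using hk
  obtain ⟨k, hk⟩ : ∃ k, m (A ∩ I k) ≠ 0 := by
    by_contra! h
    exact hA0 (measure_mono_null_ae hcover (measure_iUnion_null h))
  obtain ⟨B, hBA, hB0, hB⟩ := exists_isLipChart_of_linearIndependent_valueAt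
    (F := fun i => (v i).approx k) (hA.inter (hI_meas k)) hk (by
      filter_upwards [ae_all_iff.2 fun i => LipModule.ae_value_coe ((v i).approx k)]
        with x hcoe hx
      simpa only [Set.mem_ofPred_eq, hcoe] using hI k hx.2)
  exact ⟨B, hBA.trans Set.inter_subset_left, hB0, hB⟩

theorem LocallyIndependent.encard_le (hA : MeasurableSet A) (hA0 : m A ≠ 0)
    (hchart : ∀ B ⊆ A, IsLipChart m (n + 1) B → m B = 0) {S : Set (LipModule p m)}
    (hS : LocallyIndependent S A) : S.encard ≤ n := by
  by_contra! hlt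
  obtain ⟨T, hTS, hT⟩ := Set.exists_subset_encard_eq (k := (n + 1 : ℕ)) (s := S)
    (by push_cast; exact Order.add_one_le_of_lt hlt)
  lift T to Finset (LipModule p m) using Set.finite_of_encard_eq_coe hT
  rw [Set.encard_coe_eq_coe_finsetCard, Nat.cast_inj] at hT
  obtain ⟨B, hBA, hB0, hB⟩ := exists_isLipChart_of_linearIndependent_value hA hA0
    (v := fun i => ((T.equivFinOfCardEq hT).symm i).1) (by
      filter_upwards [locallyIndependent_iff.1 hS T hTS] with x hx hxA
      exact (hx hxA).comp _ (Equiv.injective _))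
  exact hB0 (hchart B hBA hB)

theorem nullMeasurableSet_valueAt_notMem_span {ι : Type*} [Finite ι] (hA : MeasurableSet A)
    {v : ι → LipModule p m}
    (hv : ∀ᵐ x ∂m, x ∈ A → LinearIndependent ℝ fun i => (v i).value x) (F : Pfm p m) :
    NullMeasurableSet {x | x ∈ A ∧
      F.valueAt x ∉ Submodule.span ℝ (Set.range fun i => (v i).value x)} m := by
  let w : Option ι → LipModule p m := fun o => o.elim (F : LipModule p m) v
  refine (hA.nullMeasurableSet.inter
    (LipModule.nullMeasurableSet_linearIndependent_value w)).congr ?_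
  filter_upwards [hv, LipModule.ae_value_coe F] with x hx hF
  refine propext (and_congr_right fun hxA => linearIndependent_option.trans ?_)
  rw [← hF]
  exact and_iff_right (hx hxA)

theorem exists_pfm_valueAt_notMem {κ : Type*} [Countable κ] (F : κ → Pfm p m)
    {W : (x : M) → Submodule ℝ (CotangentSpace x)}
    (hmeas : ∀ k, NullMeasurableSet {x | x ∈ A ∧ (F k).valueAt x ∉ W x} m)
    (hF : ∀ᵐ x ∂m, x ∈ A → ∃ k, (F k).valueAt x ∉ W x) :
    ∃ G : Pfm p m, SupportedOn (G : LipModule p m) A ∧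
      ∀ᵐ x ∂m, x ∈ A → G.valueAt x ∉ W x := by
  choose B hB hB_meas hB_ae using fun k => (hmeas k).exists_measurable_subset_ae_eq
  let B' : Option κ → Set M := fun o => o.elim (⋃ k, B k)ᶜ B
  let F' : Option κ → Pfm p m := fun o => o.elim 0 F
  obtain ⟨h, ε, hε, hle⟩ := exists_pos_abs_smul_le fun o => (F' o).pnorm
  obtain ⟨G, hG⟩ := Pfm.exists_valueAt_eq_of_cover (A := B') (h := h)
    (Option.rec (MeasurableSet.iUnion hB_meas).compl hB_meas) (fun x => by
      rcases em (x ∈ ⋃ k, B k) with hx | hx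
      · exact (Set.mem_iUnion.1 hx).imp' some fun _ => id
      · exact ⟨none, hx⟩)
    (fun o => ε o • F' o) fun o => by
      rw [Pfm.pnorm_smul, abs_of_pos (hε o)]
      exact (le_abs_self _).trans (hle o)
  refine ⟨G, supportedOn_coe fun x hx => ?_, ?_⟩
  · obtain ⟨_ | k, hxB, hGx⟩ := hG x
    · simpa [F'] using hGx
    · exact absurd (hB k hxB).1 hx
  · filter_upwards [hF, ae_all_iff.2 hB_ae] with x hx hae hxA
    obtain ⟨k, hk⟩ := hx hxA
    have hxB : x ∈ ⋃ k, B k := Set.mem_iUnion.2 ⟨k, (hae k).mpr ⟨hxA, hk⟩⟩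
    obtain ⟨_ | j, hxj, hGx⟩ := hG x
    · exact absurd hxB hxj
    · rw [hGx, map_smul, Submodule.smul_mem_iff _ (hε _).ne']
      exact (hB j hxj).2

theorem exists_pfm_valueAt_notMem_span (hm : ∀ s : Set M, Bornology.IsBounded s → m s < ∞)
    (hA : MeasurableSet A) {D : Set (Set M)} (hD_countable : D.Countable)
    (hD : ∀ s ∈ D, IsLipChart m n s) (hAD : A ⊆ ⋃₀ D) {ι : Type*} [Fintype ι]
    (hcard : Fintype.card ι < n) {v : ι → LipModule p m}
    (hv : ∀ᵐ x ∂m, x ∈ A → LinearIndependent ℝ fun i => (v i).value x) :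
    ∃ F : Pfm p m, SupportedOn (F : LipModule p m) A ∧ ∀ᵐ x ∂m, x ∈ A →
      F.valueAt x ∉ Submodule.span ℝ (Set.range fun i => (v i).value x) := by
  rcases isEmpty_or_nonempty M with hM | ⟨⟨x₀⟩⟩
  · exact ⟨0, .of_forall isEmptyElim, .of_forall isEmptyElim⟩
  have := hD_countable.to_subtype
  choose f hf using fun s : D => (hD s s.2).2
  choose F hF using fun a : D × ℕ × Fin n =>
    exists_pfm_valueAt_eq_differential (p := p) hm (f a.1 a.2.2) x₀ a.2.1
  refine exists_pfm_valueAt_notMem F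
    (fun a => nullMeasurableSet_valueAt_notMem_span hA hv (F a)) ?_
  filter_upwards [ae_all_iff.2 hf] with x hx hxA
  obtain ⟨s, hs, hxs⟩ := hAD hxA
  obtain ⟨R, hR⟩ := exists_nat_gt (dist x x₀)
  obtain ⟨i, hi⟩ := exists_notMem_span_of_card_lt (v := fun i => (v i).value x)
    (hx ⟨s, hs⟩ hxs) (by rwa [Fintype.card_fin])
  exact ⟨(⟨s, hs⟩, R, i), by rwa [hF (⟨s, hs⟩, R, i) x hR]⟩

theorem LocallyIndependent.insert {S : Set (LipModule p m)} (hS : LocallyIndependent S A)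
    (hSfin : S.Finite) {v : LipModule p m} (hvS : v ∉ S)
    (hv : ∀ᵐ x ∂m, x ∈ A → v.value x ∉ Submodule.span ℝ ((LipModule.value · x) '' S)) :
    LocallyIndependent (insert v S) A := by
  lift S to Finset (LipModule p m) using hSfin
  refine locallyIndependent_iff.2 fun T hT => ?_
  filter_upwards [hv, locallyIndependent_iff.1 hS S subset_rfl] with x hvx hSx hxA
  have hS : LinearIndepOn ℝ (LipModule.value · x) (S : Set (LipModule p m)) := hSx hxA
  exact ((linearIndepOn_insert hvS).2 ⟨hS, hvx hxA⟩).mono hT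

theorem IsMaximalIndependent.le_encard (hm : ∀ s : Set M, Bornology.IsBounded s → m s < ∞)
    (hA : MeasurableSet A) (hA0 : m A ≠ 0) {D : Set (Set M)} (hD_countable : D.Countable)
    (hD : ∀ s ∈ D, IsLipChart m n s) (hAD : A ⊆ ⋃₀ D) {S : Set (LipModule p m)}
    (hS : IsMaximalIndependent S A) : n ≤ S.encard := by
  by_contra! hlt
  have hSfin : S.Finite := Set.finite_of_encard_le_coe hlt.le
  lift S to Finset (LipModule p m) using hSfin
  rw [Set.encard_coe_eq_coe_finsetCard, Nat.cast_lt, ← Fintype.card_coe] at hlt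
  obtain ⟨F, hFA, hF⟩ := exists_pfm_valueAt_notMem_span hm hA hD_countable hD hAD hlt
    (locallyIndependent_iff.1 hS.prop.1 S subset_rfl)
  have hF' : ∀ᵐ x ∂m, x ∈ A → LipModule.value (F : LipModule p m) x ∉
      Submodule.span ℝ ((LipModule.value · x) '' (S : Set (LipModule p m))) := by
    filter_upwards [hF, LipModule.ae_value_coe F] with x hx hcoe
    rwa [hcoe, Set.image_eq_range]
  have hFS : (F : LipModule p m) ∉ (S : Set (LipModule p m)) := fun hmem =>
    hA0 <| measure_eq_zero_iff_ae_notMem.2 <| hF'.mono fun x hx hxA =>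
      hx hxA (Submodule.subset_span (Set.mem_image_of_mem _ hmem))
  refine hFS (hS.le_of_ge ⟨hS.prop.1.insert S.finite_toSet hFS hF', ?_⟩
    (Set.subset_insert _ _) (Set.mem_insert _ _))
  exact Set.forall_mem_insert.2 ⟨hFA, hS.prop.2⟩

end Charts

section Equivalence

variable {M : Type*} [MetricSpace M] [MeasurableSpace M] [BorelSpace M] {m : Measure M}
  {p : ℝ≥0∞} [Fact (1 ≤ p)] {N : ℕ}

theorem IsLipschitzDifferentiabilitySpace.lipModuleLocallyFiniteDimensional
    (hm : ∀ s : Set M, Bornology.IsBounded s → m s < ∞)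
    (h : IsLipschitzDifferentiabilitySpace m N) : LipModuleLocallyFiniteDimensional p m N := by
  rw [isLipschitzDifferentiabilitySpace_iff] at h
  have := sigmaFinite_of_isBounded hm
  choose D hD hD_countable hD_cover using fun n : ℕ =>
    exists_countable_subset_ae_cover m {A | IsLipChart m n A} fun _ hA => hA.1
  set U : ℕ → Set M := fun n => ⋃₀ D n
  have hU (n : ℕ) : MeasurableSet (U n) := .sUnion (hD_countable n) fun s hs => (hD n hs).1
  have hU_null (n : ℕ) (hn : N < n) : m (U n) = 0 :=
    (measure_sUnion_null_iff (hD_countable n)).2 fun s hs =>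
      of_not_not fun hs0 => hn.not_ge (h n s (hD n hs) hs0)
  have hlarge : m {x | (N : ℕ∞) < maxIndex U x} = 0 := by
    refine measure_mono_null (fun x hx => ?_) (measure_biUnion_null_iff
      (Set.to_countable {n : ℕ | N < n}) |>.2 hU_null)
    obtain ⟨n, hxn, hn⟩ := lt_maxIndex_iff.1 hx
    exact Set.mem_biUnion (by exact_mod_cast hn) hxn
  refine ⟨fun e => maxIndex U ⁻¹' {e}, fun e => measurable_maxIndex hU (measurableSet_singleton e),
    fun i j hij => (Set.disjoint_singleton.2 hij).preimage _,
    Set.eq_univ_of_forall fun x => Set.mem_iUnion.2 ⟨maxIndex U x, rfl⟩,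
    measure_mono_null ?_ hlarge, fun n A hAE hA hA0 S hS => le_antisymm ?_ ?_,
    fun n hn => measure_mono_null ?_ hlarge⟩
  · rintro x (hx : maxIndex U x = ⊤)
    exact (ENat.natCast_lt_top N).trans_eq hx.symm
  · refine hS.prop.1.encard_le hA hA0 fun B hBA hB => ?_
    have hBU : Disjoint B (U (n + 1)) := Set.disjoint_left.2 fun x hxB hxU => by
      have hle := hAE (hBA hxB) ▸ natCast_le_maxIndex hxU
      exact absurd (Nat.cast_le.1 hle) (by omega)
    rw [← hBU.sdiff_eq_left]
    exact hD_cover (n + 1) B hB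
  · rcases eq_or_ne n 0 with rfl | hn
    · exact zero_le
    · exact hS.le_encard hm hA hA0 (hD_countable n) (hD n) fun x hx =>
        mem_of_maxIndex_eq hn (hAE hx)
  · rintro x (hx : maxIndex U x = n)
    exact (Nat.cast_lt.2 hn).trans_eq hx.symm

theorem LipModuleLocallyFiniteDimensional.isLipschitzDifferentiabilitySpace
    (hm : ∀ s : Set M, Bornology.IsBounded s → m s < ∞)
    (h : LipModuleLocallyFiniteDimensional p m N) : IsLipschitzDifferentiabilitySpace m N := by
  obtain ⟨E, hE, -, hE_univ, hE_top, hE_max, hE_null⟩ := h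
  refine isLipschitzDifferentiabilitySpace_iff.2 fun n A hA hA0 => ?_
  obtain ⟨e, he⟩ : ∃ e, m (A ∩ E e) ≠ 0 := by
    by_contra! hnull
    rw [← Set.inter_univ A, ← hE_univ, Set.inter_iUnion] at hA0
    exact hA0 (measure_iUnion_null hnull)
  have hEe : m (E e) ≠ 0 := fun h0 => he (measure_mono_null Set.inter_subset_right h0)
  lift e to ℕ using fun htop => hEe (htop ▸ hE_top)
  have hAE : MeasurableSet (A ∩ E e) := hA.1.inter (hE e)
  obtain ⟨S, hS⟩ := exists_isMaximalIndependent (p := p) (m := m) (A ∩ E e)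
  have hn : n ≤ S.encard := hS.le_encard hm hAE he (Set.countable_singleton (A ∩ E e))
    (by rintro _ rfl; exact hA.mono hAE Set.inter_subset_left) (by simp)
  rw [hE_max e _ Set.inter_subset_right hAE he S hS, Nat.cast_le] at hn
  exact hn.trans (of_not_not fun heN => hEe (hE_null e (not_le.1 heN)))

end Equivalence

end LipMod

end

theorem mainTheorem6_general {M : Type*} [MetricSpace M] [MeasurableSpace M] [BorelSpace M]
    (m : Measure M) (hm : ∀ s : Set M, Bornology.IsBounded s → m s < ∞) (N : ℕ) (p : ℝ≥0∞)
    [Fact (1 ≤ p)] :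
    LipMod.IsLipschitzDifferentiabilitySpace m N ↔
      LipMod.LipModuleLocallyFiniteDimensional p m N :=
  ⟨fun h => h.lipModuleLocallyFiniteDimensional hm, fun h => h.isLipschitzDifferentiabilitySpace hm⟩

theorem mainTheorem6 {M : Type*} [MetricSpace M] [CompleteSpace M] [MeasurableSpace M]
    [BorelSpace M] (m : Measure M) [m.Regular]
    (hm : ∀ s : Set M, Bornology.IsBounded s → m s < ∞) (N : ℕ) :
    (LipMod.IsLipschitzDifferentiabilitySpace m N ↔
      ∃ (p : ℝ≥0∞) (_ : Fact (1 ≤ p)), 1 < p ∧ p < ∞ ∧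
        LipMod.LipModuleLocallyFiniteDimensional p m N) ∧
    (LipMod.IsLipschitzDifferentiabilitySpace m N ↔
      ∀ (p : ℝ≥0∞) [Fact (1 ≤ p)], 1 < p → p < ∞ →
        LipMod.LipModuleLocallyFiniteDimensional p m N) := by
  have main (p : ℝ≥0∞) [Fact (1 ≤ p)] := mainTheorem6_general m hm N p
  exact ⟨⟨fun h => ⟨2, inferInstance, ENNReal.one_lt_two, ENNReal.ofNat_lt_top, (main 2).1 h⟩,
      fun ⟨p, _, _, _, h⟩ => (main p).2 h⟩,
    ⟨fun h p _ _ _ => (main p).1 h,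
      fun h => (main 2).2 (h 2 ENNReal.one_lt_two ENNReal.ofNat_lt_top)⟩⟩
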